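/- Let $N\ge 2$ and let players $i=1,\dots,N$ have scalar actions $x_i\in\mathbb R$ and cost functions $f_i:\mathbb R^N\to\mathbb R$. An action profile $\mathbf x^*$ is a Nash equilibrium if, for every $i$, $f_i(x_i^*,\mathbf x_{-i}^*)\le f_i(x_i,\mathbf x_{-i}^*)$ for all $x_i\in\mathbb R$. Assume: (a) each $f_i$ is twice continuously differentiable, and each $\frac{\partial f_i}{\partial x_i}:\mathbb R^N\to\mathbb R$ is globally Lipschitz; (b) with $\Upsilon(\mathbf x)=\big(\frac{\partial f_1}{\partial x_1}(\mathbf x),\dots,\frac{\partial f_N}{\partial x_N}(\mathbf x)\big)^T$, there is $m>0$ such that $(\mathbf x-\mathbf z)^T(\Upsilon(\mathbf x)-\Upsilon(\mathbf z))\ge m\|\mathbf x-\mathbf z\|^2$ for all $\mathbf x,\mathbf z\in\mathbb R^N$; (c) $(a_{ij})$ is the adjacency matrix of an undirected connected weighted graph on the players, that is, $a_{ij}=a_{ji}\ge 0$, $a_{ii}=0$, and the graph with an edge between $i$ and $j$ whenever $a_{ij}>0$ is connected; (d) the disturbances $d_i$ are continuously differentiable on $[t_0,\infty)$ with $\dot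 d_i$ bounded there. Fix positive constants $\bar\theta_{ij},k_{i1},k_{i2}$. For gains $\theta,\sigma>0$ consider, for $t\ge t_0$, the closed-loop system $$\dot x_i=u_i+d_i(t),\qquad u_i=-\frac{\partial f_i}{\partial x_i}(\mathbf y_i)-\hat z_i,\qquad \mathbf y_i=(y_{i1},\dots,y_{iN})^T,$$ $$\dot y_{ij}=-\theta\bar\theta_{ij}\Big(\sum_{k=1}^N a_{ik}(y_{ij}-y_{kj})+a_{ij}(y_{ij}-x_j)\Big),$$ $$\dot{\hat x}_i=u_i+\hat z_i+\sigma k_{i1}(x_i-\hat x_i),\qquad \dot{\hat z}_i=\sigma^2k_{i2}(x_i-\hat x_i).$$ Then the game has exactly one Nash equilibrium $\mathbf x^*$. Let $\mathcal E(t)$ be the vector with entries $x_i-\hat x_i$, $d_i(t)-\hat z_i$, $y_{ij}-x_j$ and $x_i-x_i^*$ $(1\le i,j\le N)$, and let $\|\cdot\|$ be the Euclidean norm. There is a constant $\theta^*>0$ such that for every $v_1>0$ there is a constant $\sigma^*=\sigma^*(v_1)>0$ such that for all $\theta\in(\theta^*,\infty)$ and $\sigma\in(\sigma^*,\infty)$: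 for every initial condition at $t_0$ the closed-loop system has a solution on $[t_0,\infty)$, and for every solution on $[t_0,\infty)$ (whatever its initial condition) there is $\bar T\ge t_0$ such that $\|\mathcal E(t)\|\le v_1$ for all $t\ge\bar T$. -/

import Mathlib

open scoped NNReal

noncomputable section

namespace NashSeeking

/-- Action profiles of `N` players with scalar actions: `ℝ^N` with the Euclidean norm. -/
abbrev Profile (N : ℕ) := EuclideanSpace ℝ (Fin N)

/-- The partial derivative `∂g/∂x_i` at `x`. -/
def partialDeriv {N : ℕ} (g : Profile N → ℝ) (i : Fin N) (x : Profile N) : ℝ :=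
  fderiv ℝ g x (EuclideanSpace.single i 1)

/-- The pseudo-gradient `Υ(x) = [∂f_i/∂x_i (x)]_vec`. -/
def pseudoGradient {N : ℕ} (f : Fin N → Profile N → ℝ) (x : Profile N) : Profile N :=
  WithLp.toLp 2 fun i => partialDeriv (f i) i x

/-- Strong monotonicity of the pseudo-gradient, with some constant `m > 0`. -/
def StronglyMonotone {N : ℕ} (f : Fin N → Profile N → ℝ) : Prop :=
  ∃ m : ℝ, 0 < m ∧ ∀ x z : Profile N,
    m * ‖x - z‖ ^ 2 ≤ inner ℝ (x - z) (pseudoGradient f x - pseudoGradient f z)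

/-- Nash equilibrium: no player lowers its own cost by a unilateral change of its action. -/
def IsNashEquilibrium {N : ℕ} (f : Fin N → Profile N → ℝ) (xs : Profile N) : Prop :=
  ∀ (i : Fin N) (s : ℝ), f i xs ≤ f i (WithLp.toLp 2 (Function.update (fun j => xs j) i s))

/-- `a` is the adjacency matrix of an undirected, connected weighted graph without loops. -/
structure IsUndirectedConnected {N : ℕ} (a : Matrix (Fin N) (Fin N) ℝ) : Prop where
  nonneg : ∀ i j, 0 ≤ a i j
  diag : ∀ i, a i i = 0
  symm : ∀ i j, a i j = a j i
  connected : (SimpleGraph.fromRel fun i j => 0 < a i j).Connected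

/-- The disturbance is continuously differentiable, with bounded derivative, on `[t₀, ∞)`. -/
structure IsAdmissibleDisturbance {N : ℕ} (t₀ : ℝ) (d : Fin N → ℝ → ℝ) : Prop where
  contDiffOn : ∀ i, ContDiffOn ℝ 1 (d i) (Set.Ici t₀)
  bounded : ∀ i, ∃ D : ℝ, ∀ t, t₀ ≤ t → |derivWithin (d i) (Set.Ici t₀) t| ≤ D

/-- The value of the closed-loop state: the actions `x`, the estimates `y i` of all the actions
held by player `i`, and the states `xhat`, `zhat` of the observers. -/
structure State (N : ℕ) where
  x : Profile N
  y : Fin N → Profile N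
  xhat : Profile N
  zhat : Profile N

/-- The control input `u_i = -∂f_i/∂x_i (y_i) - ẑ_i`. -/
def controlInput {N : ℕ} (f : Fin N → Profile N → ℝ) (S : State N) (i : Fin N) : ℝ :=
  -partialDeriv (f i) i (S.y i) - S.zhat i

/-- `S` solves the closed-loop system on `[t₀, ∞)` with gains `θ_ij = θ * θbar i j`,
`σ * k₁ i` and `σ² * k₂ i` (one-sided derivatives at `t₀`). -/
structure IsClosedLoopSolution {N : ℕ} (f : Fin N → Profile N → ℝ)
    (a : Matrix (Fin N) (Fin N) ℝ) (θbar : Fin N → Fin N → ℝ) (k₁ k₂ : Fin N → ℝ)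
    (d : Fin N → ℝ → ℝ) (t₀ θ σ : ℝ) (S : ℝ → State N) : Prop where
  x_deriv : ∀ i t, t₀ ≤ t → HasDerivWithinAt (fun s => (S s).x i)
    (controlInput f (S t) i + d i t) (Set.Ici t₀) t
  y_deriv : ∀ i j t, t₀ ≤ t → HasDerivWithinAt (fun s => (S s).y i j)
    (-(θ * θbar i j) * ((∑ k, a i k * ((S t).y i j - (S t).y k j))
      + a i j * ((S t).y i j - (S t).x j))) (Set.Ici t₀) t
  xhat_deriv : ∀ i t, t₀ ≤ t → HasDerivWithinAt (fun s => (S s).xhat i)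
    (controlInput f (S t) i + (S t).zhat i + σ * k₁ i * ((S t).x i - (S t).xhat i))
    (Set.Ici t₀) t
  zhat_deriv : ∀ i t, t₀ ≤ t → HasDerivWithinAt (fun s => (S s).zhat i)
    (σ ^ 2 * k₂ i * ((S t).x i - (S t).xhat i)) (Set.Ici t₀) t

/-- The total error `[ζ₁, ζ₂, η, ξ]`, where `ζ₁ = x - x̂`, `ζ₂ = d(t) - ẑ`,
`η_ij = y_ij - x_j` and `ξ = x - x*`, as a vector with the Euclidean norm. -/
def totalError {N : ℕ} (xs : Profile N) (d : Fin N → ℝ → ℝ) (t : ℝ) (S : State N) :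
    EuclideanSpace ℝ (Fin N ⊕ Fin N ⊕ (Fin N × Fin N) ⊕ Fin N) :=
  WithLp.toLp 2 (Sum.elim (fun i => S.x i - S.xhat i)
    (Sum.elim (fun i => d i t - S.zhat i)
      (Sum.elim (fun p => S.y p.1 p.2 - S.x p.2) (fun i => S.x i - xs i))))

end NashSeeking

end

/-!
A Nash equilibrium is the same as a zero of the pseudo-gradient: along each axis the own cost has a
derivative whose sign is dictated by strong monotonicity. As the pseudo-gradient `Υ` is also
Lipschitz, `x ↦ x - γ Υ(x)` is a contraction for small `γ`, so there is exactly one such zero `x*`.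

In the scaled errors `σ ζ₁` and `ζ₂`, with `ζ₁ = x - x̂` and `ζ₂ = d - ẑ`, an observer is a stable
linear system sped up by `σ` and driven by the bounded `ḋ`. A quadratic Lyapunov function shows that
`ζ₁² + ζ₂²` is ultimately of order `σ⁻²`, uniformly in all the other components of the system.

What remains is `ẋ_i = ζ₂_i - ∂f_i/∂x_i(y_i)` coupled to the consensus dynamics of `η_i = y_i - x`.
For each `j` the errors `η_ij` evolve by the Laplacian of the graph pinned at the neighbours of `j`,
which is positive definite since the graph is connected. So the energy of `η` and `x - x*` decays
at the rate `θ l ‖η‖² + m ‖x - x*‖²`, up to cross terms that Young's inequality bounds by a multiple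
of `‖η‖² + ‖ζ₂‖²` and a part of `m ‖x - x*‖²`. Hence a gain `θ` independent of the target accuracy
makes the energy ultimately proportional to the bound on `‖ζ₂‖²`, which is then made small by `σ`.

Solutions are global because the field is Lipschitz in the state uniformly in time: Picard-Lindelöf
gives solutions on intervals of a fixed length, which are glued.
-/

theorem exists_lipschitzWith_forall {ι α β : Type*} [Finite ι] [PseudoEMetricSpace α]
    [PseudoEMetricSpace β] {g : ι → α → β} (hg : ∀ i, ∃ K, LipschitzWith K (g i)) :
    ∃ K, ∀ i, LipschitzWith K (g i) := by
  choose K hK using hg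
  obtain ⟨L, hL⟩ := Finite.exists_le K
  exact ⟨L, fun i => (hK i).weaken (hL i)⟩

theorem exists_lipschitzWith_pi {ι α : Type*} [Fintype ι] [PseudoEMetricSpace α]
    {g : α → ι → ℝ} (hg : ∀ i, ∃ K, LipschitzWith K fun x => g x i) :
    ∃ K, LipschitzWith K g := by
  obtain ⟨K, hK⟩ := exists_lipschitzWith_forall hg
  exact ⟨K, fun x z => edist_pi_le_iff.2 fun i => hK i x z⟩

theorem exists_lipschitzWith_sum {ι α F : Type*} [PseudoEMetricSpace α]
    [SeminormedAddCommGroup F] (s : Finset ι) {g : ι → α → F}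
    (hg : ∀ i, ∃ K, LipschitzWith K (g i)) : ∃ K, LipschitzWith K fun x => ∑ i ∈ s, g i x := by
  classical
  choose K hK using hg
  induction s using Finset.induction_on with
  | empty => exact ⟨0, by simpa using LipschitzWith.const (0 : F)⟩
  | insert i s hi ih =>
    obtain ⟨L, hL⟩ := ih
    simp only [Finset.sum_insert hi]
    exact ⟨_, (hK i).add hL⟩

theorem exists_one_le_forall_inv_le_and_le {ι : Type*} [Finite ι] {w : ι → ℝ}
    (hw : ∀ i, 0 < w i) : ∃ c : ℝ, 1 ≤ c ∧ ∀ i, c⁻¹ ≤ w i ∧ w i ≤ c := by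
  obtain ⟨A, hA⟩ := Finite.exists_le w
  obtain ⟨B, hB⟩ := Finite.exists_le fun i => (w i)⁻¹
  refine ⟨max 1 (max A B), le_max_left _ _, fun i => ⟨?_, ?_⟩⟩
  · exact inv_le_of_inv_le₀ (hw i) ((hB i).trans (by simp))
  · exact (hA i).trans (by simp)

section ODE

open Filter Set Topology

variable {E : Type*} [NormedAddCommGroup E] [NormedSpace ℝ E] {v : ℝ → E → E} {t₀ h : ℝ}

theorem exists_isIntegralCurveOn_Icc_of_lipschitzWith [CompleteSpace E] {K : ℝ≥0} (hh : 0 ≤ h)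
    (hKh : 2 * (K + 1) * h ≤ 1) (hv : ∀ t ∈ Icc t₀ (t₀ + h), LipschitzWith K (v t))
    (hcont : ∀ x, ContinuousOn (v · x) (Icc t₀ (t₀ + h))) (x₀ : E) :
    ∃ γ : ℝ → E, γ t₀ = x₀ ∧ IsIntegralCurveOn γ v (Icc t₀ (t₀ + h)) := by
  obtain ⟨M, hM⟩ := isCompact_Icc.exists_bound_of_continuousOn (hcont x₀)
  have ht₀ : t₀ ∈ Icc t₀ (t₀ + h) := ⟨le_rfl, by linarith⟩
  lift M to ℝ≥0 using (norm_nonneg _).trans (hM t₀ ht₀)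
  -- On the ball of radius `M / (K + 1)` around `x₀` the field is bounded by `2 * M`.
  have field_le {t : ℝ} (ht : t ∈ Icc t₀ (t₀ + h)) {x : E}
      (hx : x ∈ Metric.closedBall x₀ ((M / (K + 1) : ℝ≥0) : ℝ)) : ‖v t x‖ ≤ (2 * M : ℝ≥0) := by
    have hvar : ‖v t x - v t x₀‖ ≤ K * (M / (K + 1)) := by
      refine ((hv t ht).norm_sub_le x x₀).trans ?_
      gcongr
      simpa [dist_eq_norm] using hx
    have hKM : (K : ℝ) * (M / (K + 1)) ≤ M := by
      rw [mul_div_assoc', div_le_iff₀ (by positivity)]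
      nlinarith [M.coe_nonneg]
    push_cast
    linarith [norm_sub_norm_le (v t x) (v t x₀), hM t ht]
  have hPL : IsPicardLindelof v (⟨t₀, ht₀⟩ : Icc t₀ (t₀ + h)) x₀ (M / (K + 1)) 0 (2 * M) K := by
    refine ⟨fun t ht => (hv t ht).lipschitzOnWith, fun x _ => hcont x,
      fun t ht x hx => field_le ht hx, ?_⟩
    simp only [add_sub_cancel_left, sub_self, NNReal.coe_zero, sub_zero, max_eq_left hh]
    push_cast
    rw [le_div_iff₀ (by positivity)]
    nlinarith [M.coe_nonneg]
  exact hPL.exists_eq_forall_mem_Icc_hasDerivWithinAt₀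

theorem floor_sub_div_eq_iff (hh : 0 < h) {t : ℝ} (ht : t₀ ≤ t) {n : ℕ} :
    ⌊(t - t₀) / h⌋₊ = n ↔ t ∈ Ico (t₀ + n * h) (t₀ + (n + 1 : ℕ) * h) := by
  rw [Nat.floor_eq_iff (div_nonneg (sub_nonneg.2 ht) hh.le), le_div_iff₀ hh, div_lt_iff₀ hh,
    le_sub_iff_add_le', sub_lt_iff_lt_add', mem_Ico, Nat.cast_succ]

theorem hasDerivWithinAt_Ici_of_forall_Icc (hh : 0 < h) {γ γ' : ℝ → E}
    (hγ : ∀ n : ℕ, ∀ t ∈ Icc (t₀ + n * h) (t₀ + (n + 1 : ℕ) * h),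
      HasDerivWithinAt γ (γ' t) (Icc (t₀ + n * h) (t₀ + (n + 1 : ℕ) * h)) t) {t : ℝ}
    (ht : t₀ ≤ t) : HasDerivWithinAt γ (γ' t) (Ici t₀) t := by
  obtain ⟨n, hn, hn'⟩ : ∃ n : ℕ, t ∈ Ico (t₀ + n * h) (t₀ + (n + 1 : ℕ) * h) :=
    ⟨_, (floor_sub_div_eq_iff hh ht).1 rfl⟩
  have right := hγ n t ⟨hn, hn'.le⟩
  rcases hn.lt_or_eq with hlt | rfl
  · exact (right.hasDerivAt (Icc_mem_nhds hlt hn')).hasDerivWithinAt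
  · cases n with
    | zero =>
      refine right.mono_of_mem_nhdsWithin ?_
      simpa using Icc_mem_nhdsGE hn'
    | succ n =>
      have hlt : t₀ + n * h < t₀ + (n + 1 : ℕ) * h := by push_cast; linarith
      refine ((hγ n _ (right_mem_Icc.2 hlt.le)).union right).hasDerivAt ?_ |>.hasDerivWithinAt
      rw [Icc_union_Icc_eq_Icc hlt.le hn'.le]
      exact Icc_mem_nhds hlt hn'

theorem exists_isIntegralCurveOn_Ici_of_forall_Icc (hh : 0 < h)
    (hloc : ∀ s, t₀ ≤ s → ∀ x, ∃ γ : ℝ → E, γ s = x ∧ IsIntegralCurveOn γ v (Icc s (s + h)))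
    (x₀ : E) : ∃ γ : ℝ → E, γ t₀ = x₀ ∧ IsIntegralCurveOn γ v (Ici t₀) := by
  have node_succ (n : ℕ) : t₀ + (n + 1 : ℕ) * h = t₀ + n * h + h := by push_cast; ring
  have step (n : ℕ) (x : E) : ∃ γ : ℝ → E, γ (t₀ + n * h) = x ∧
      IsIntegralCurveOn γ v (Icc (t₀ + n * h) (t₀ + (n + 1 : ℕ) * h)) := by
    rw [node_succ]
    exact hloc _ (le_add_of_nonneg_right (by positivity)) x
  choose φ hφ₀ hφ using step
  let e : ℕ → E := fun n => Nat.rec x₀ (fun n x => φ n x (t₀ + (n + 1 : ℕ) * h)) n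
  let γ : ℝ → E := fun t => φ ⌊(t - t₀) / h⌋₊ (e ⌊(t - t₀) / h⌋₊) t
  have γ_eq_of_lt {n : ℕ} {t : ℝ} (hn : t₀ + n * h ≤ t) (hn' : t < t₀ + (n + 1 : ℕ) * h) :
      γ t = φ n (e n) t := by
    have ht : t₀ ≤ t := (le_add_of_nonneg_right (by positivity)).trans hn
    simp only [γ, (floor_sub_div_eq_iff hh ht).2 ⟨hn, hn'⟩]
  have γ_node (n : ℕ) : γ (t₀ + n * h) = e n := by
    rw [γ_eq_of_lt le_rfl (by rw [node_succ]; linarith), hφ₀]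
  have γ_eq {n : ℕ} {t : ℝ} (ht : t ∈ Icc (t₀ + n * h) (t₀ + (n + 1 : ℕ) * h)) :
      γ t = φ n (e n) t := by
    rcases ht.2.lt_or_eq with hlt | rfl
    · exact γ_eq_of_lt ht.1 hlt
    · exact γ_node (n + 1)
  refine ⟨γ, by simpa [e] using γ_node 0, fun t ht => ?_⟩
  refine hasDerivWithinAt_Ici_of_forall_Icc (γ' := fun t => v t (γ t)) hh (fun n t ht => ?_) ht
  simp only [γ_eq ht]
  exact (hφ n (e n) t ht).congr (fun _ => γ_eq) (γ_eq ht)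

theorem exists_isIntegralCurveOn_Ici_of_lipschitzWith [CompleteSpace E] {K : ℝ≥0}
    (hv : ∀ t, t₀ ≤ t → LipschitzWith K (v t)) (hcont : ∀ x, ContinuousOn (v · x) (Ici t₀))
    (x₀ : E) : ∃ γ : ℝ → E, γ t₀ = x₀ ∧ IsIntegralCurveOn γ v (Ici t₀) := by
  have hK : 2 * (K + 1) * (1 / (2 * (K + 1)) : ℝ) ≤ 1 := (mul_one_div_cancel (by positivity)).le
  refine exists_isIntegralCurveOn_Ici_of_forall_Icc (h := 1 / (2 * (K + 1))) (by positivity)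
    (fun s hs x => ?_) x₀
  exact exists_isIntegralCurveOn_Icc_of_lipschitzWith (by positivity) hK
    (fun t ht => hv t (hs.trans ht.1)) (fun x => (hcont x).mono fun t ht => hs.trans ht.1) x

end ODE

section StrongMonotonicity

variable {E : Type*} [NormedAddCommGroup E] [InnerProductSpace ℝ E] {G : E → E} {m γ : ℝ}
  {L : ℝ≥0}

theorem norm_sub_smul_sub_sub_smul_sq_le (hγ : 0 ≤ γ)
    (hG : ∀ x z, m * ‖x - z‖ ^ 2 ≤ inner ℝ (x - z) (G x - G z)) (hL : LipschitzWith L G)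
    (x z : E) :
    ‖(x - γ • G x) - (z - γ • G z)‖ ^ 2 ≤ (1 - 2 * γ * m + γ ^ 2 * L ^ 2) * ‖x - z‖ ^ 2 := by
  have hLip : ‖G x - G z‖ ^ 2 ≤ L ^ 2 * ‖x - z‖ ^ 2 := by
    rw [← mul_pow]
    gcongr
    exact hL.norm_sub_le x z
  calc ‖(x - γ • G x) - (z - γ • G z)‖ ^ 2
      = ‖x - z‖ ^ 2 - 2 * γ * inner ℝ (x - z) (G x - G z) + γ ^ 2 * ‖G x - G z‖ ^ 2 := by
        rw [sub_sub_sub_comm, ← smul_sub, norm_sub_sq_real, inner_smul_right, norm_smul, mul_pow,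
          Real.norm_eq_abs, sq_abs, mul_assoc 2]
    _ ≤ ‖x - z‖ ^ 2 - 2 * γ * (m * ‖x - z‖ ^ 2) + γ ^ 2 * (L ^ 2 * ‖x - z‖ ^ 2) := by
        gcongr
        exact hG x z
    _ = (1 - 2 * γ * m + γ ^ 2 * L ^ 2) * ‖x - z‖ ^ 2 := by ring

theorem exists_contractingWith_sub_smul (hm : 0 < m)
    (hG : ∀ x z, m * ‖x - z‖ ^ 2 ≤ inner ℝ (x - z) (G x - G z)) (hL : LipschitzWith L G) :
    ∃ γ : ℝ, 0 < γ ∧ ∃ q, ContractingWith q fun x => x - γ • G x := by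
  have hγ : 0 < m / (L ^ 2 + m ^ 2) := by positivity
  set γ : ℝ := m / (L ^ 2 + m ^ 2)
  have hγL : γ * (L ^ 2 + m ^ 2) = m := div_mul_cancel₀ _ (by positivity)
  have hq : 1 - 2 * γ * m + γ ^ 2 * L ^ 2 < 1 := by
    nlinarith [mul_pos hγ hm, sq_nonneg (γ * m)]
  refine ⟨γ, hγ, (√(1 - 2 * γ * m + γ ^ 2 * L ^ 2)).toNNReal, ?_, ?_⟩
  · rw [Real.toNNReal_lt_one, Real.sqrt_lt' one_pos, one_pow]
    exact hq
  · refine LipschitzWith.of_dist_le_mul fun x z => ?_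
    rw [dist_eq_norm, dist_eq_norm, Real.coe_toNNReal _ (Real.sqrt_nonneg _),
      ← Real.sqrt_sq (norm_nonneg (x - z)), ← Real.sqrt_mul' _ (sq_nonneg _)]
    exact Real.le_sqrt_of_sq_le (norm_sub_smul_sub_sub_smul_sq_le hγ.le hG hL x z)

theorem existsUnique_eq_zero_of_stronglyMonotone [CompleteSpace E] (hm : 0 < m)
    (hG : ∀ x z, m * ‖x - z‖ ^ 2 ≤ inner ℝ (x - z) (G x - G z)) (hL : LipschitzWith L G) :
    ∃! x, G x = 0 := by
  obtain ⟨γ, hγ, q, hq⟩ := exists_contractingWith_sub_smul hm hG hL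
  have fixed_iff (x : E) : Function.IsFixedPt (fun x => x - γ • G x) x ↔ G x = 0 := by
    simp only [Function.IsFixedPt, sub_eq_self, smul_eq_zero, hγ.ne', false_or]
  exact ⟨hq.fixedPoint, (fixed_iff _).1 hq.fixedPoint_isFixedPt,
    fun x hx => hq.fixedPoint_unique ((fixed_iff x).2 hx)⟩

end StrongMonotonicity

section UltimateBound

open Filter Set Topology

variable {V : ℝ → ℝ} {b : ℝ}

theorem eventually_lt_of_hasDerivAt_of_le {c δ : ℝ} (hc : 0 < c) (hδ : 0 < δ)
    (hV : ∀ᶠ t in atTop, ∃ V', HasDerivAt V V' t ∧ V' ≤ -c * V t + b) :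
    ∀ᶠ t in atTop, V t < b / c + δ := by
  obtain ⟨T, hT⟩ := eventually_atTop.1 hV
  choose! V' hV' hle using hT
  have gronwall (t : ℝ) (ht : T ≤ t) : V t ≤ gronwallBound (V T) (-c) b (t - T) :=
    le_gronwallBound_of_liminf_deriv_right_le
      (fun s hs => (hV' s hs.1).continuousAt.continuousWithinAt)
      (fun s hs _ hr => (hV' s hs.1).hasDerivWithinAt.liminf_right_slope_le hr) le_rfl
      (fun s hs => hle s hs.1) t ⟨ht, le_rfl⟩
  have hexp : Tendsto (fun t => Real.exp (-c * (t - T))) atTop (𝓝 0) :=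
    Real.tendsto_exp_atBot.comp
      ((tendsto_atTop_add_const_right _ (-T) tendsto_id).const_mul_atTop_of_neg (neg_neg_of_pos hc))
  have hlim : Tendsto (fun t => gronwallBound (V T) (-c) b (t - T)) atTop (𝓝 (b / c)) := by
    rw [gronwallBound_of_K_ne_0 (neg_ne_zero.2 hc.ne')]
    simpa [neg_div, div_neg] using
      (hexp.const_mul (V T)).add ((hexp.sub_const 1).const_mul (b / -c))
  filter_upwards [eventually_ge_atTop T, hlim.eventually_lt_const (lt_add_of_pos_right _ hδ)]
    with t ht hlt using (gronwall t ht).trans_lt hlt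

theorem eventually_lt_of_lyapunov {w : ℝ → ℝ} {p q κ ε : ℝ} (hp : 0 < p) (hq : 0 < q)
    (hκ : 0 < κ) (hε : q * b / (κ * p) < ε) (hpV : ∀ᶠ t in atTop, p * w t ≤ V t)
    (hVq : ∀ᶠ t in atTop, V t ≤ q * w t)
    (hV : ∀ᶠ t in atTop, ∃ V', HasDerivAt V V' t ∧ V' ≤ -κ * w t + b) :
    ∀ᶠ t in atTop, w t < ε := by
  have hgap : 0 < p * (ε - q * b / (κ * p)) := mul_pos hp (sub_pos.2 hε)
  have decay : ∀ᶠ t in atTop, ∃ V', HasDerivAt V V' t ∧ V' ≤ -(κ / q) * V t + b := by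
    filter_upwards [hV, hVq] with t ⟨V', hV', hle⟩ hVq
    refine ⟨V', hV', ?_⟩
    have : κ / q * V t ≤ κ * w t := by
      rw [div_mul_eq_mul_div, div_le_iff₀ hq, mul_assoc, mul_comm (w t)]
      gcongr
    linarith
  filter_upwards [hpV, eventually_lt_of_hasDerivAt_of_le (div_pos hκ hq) hgap decay]
    with t hpV hlt
  have hlevel : b / (κ / q) + p * (ε - q * b / (κ * p)) = p * ε := by
    field_simp
    ring
  exact lt_of_mul_lt_mul_left (by linarith) hp.le

end UltimateBound

section Observer

open Filter

variable {k₁ k₂ : ℝ}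

/-- The coefficient `α` of `e₁ ^ 2` in `observerEnergy`, the solution of `2 α k₁ = 1 + k₂`. -/
noncomputable def observerCoeff₁ (k₁ k₂ : ℝ) : ℝ := (1 + k₂) / (2 * k₁)

/-- The coefficient `γ` of `e₂ ^ 2` in `observerEnergy`, the solution of `γ k₂ = α + k₁ / 2` with
`α = observerCoeff₁ k₁ k₂`. -/
noncomputable def observerCoeff₂ (k₁ k₂ : ℝ) : ℝ := (observerCoeff₁ k₁ k₂ + k₁ / 2) / k₂

/-- The Lyapunov function of the extended state observer in the scaled errors `e₁ = σ ζ₁`,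
`e₂ = ζ₂`: the quadratic form whose derivative along `e₁' = σ (e₂ - k₁ e₁)`, `e₂' = -σ k₂ e₁` is
`-σ (e₁ ^ 2 + e₂ ^ 2)`. -/
noncomputable def observerEnergy (k₁ k₂ e₁ e₂ : ℝ) : ℝ :=
  observerCoeff₁ k₁ k₂ * e₁ ^ 2 - e₁ * e₂ + observerCoeff₂ k₁ k₂ * e₂ ^ 2

theorem observerCoeff₁_pos (hk₁ : 0 < k₁) (hk₂ : 0 < k₂) : 0 < observerCoeff₁ k₁ k₂ := by
  unfold observerCoeff₁
  positivity

theorem observerCoeff₂_pos (hk₁ : 0 < k₁) (hk₂ : 0 < k₂) : 0 < observerCoeff₂ k₁ k₂ := by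
  have := observerCoeff₁_pos hk₁ hk₂
  unfold observerCoeff₂
  positivity

theorem two_mul_observerCoeff₁_mul (hk₁ : k₁ ≠ 0) (k₂ : ℝ) :
    2 * observerCoeff₁ k₁ k₂ * k₁ = 1 + k₂ := by
  unfold observerCoeff₁
  field_simp

theorem observerCoeff₂_mul (k₁ : ℝ) (hk₂ : k₂ ≠ 0) :
    observerCoeff₂ k₁ k₂ * k₂ = observerCoeff₁ k₁ k₂ + k₁ / 2 :=
  div_mul_cancel₀ _ hk₂

theorem one_lt_four_mul_observerCoeff_mul (hk₁ : 0 < k₁) (hk₂ : 0 < k₂) :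
    1 < 4 * (observerCoeff₁ k₁ k₂ * observerCoeff₂ k₁ k₂) := by
  have hα := two_mul_observerCoeff₁_mul hk₁.ne' k₂
  have hγ := observerCoeff₂_mul k₁ hk₂.ne'
  have hα₀ := observerCoeff₁_pos hk₁ hk₂
  refine lt_of_mul_lt_mul_right ?_ hk₂.le
  calc 1 * k₂ < 2 * observerCoeff₁ k₁ k₂ * k₁ := by linarith
    _ ≤ 4 * observerCoeff₁ k₁ k₂ * (observerCoeff₁ k₁ k₂ + k₁ / 2) := by nlinarith
    _ = 4 * (observerCoeff₁ k₁ k₂ * observerCoeff₂ k₁ k₂) * k₂ := by rw [← hγ]; ring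

theorem exists_pos_mul_le_observerEnergy (hk₁ : 0 < k₁) (hk₂ : 0 < k₂) :
    ∃ p : ℝ, 0 < p ∧ ∀ e₁ e₂, p * (e₁ ^ 2 + e₂ ^ 2) ≤ observerEnergy k₁ k₂ e₁ e₂ := by
  have hdet := one_lt_four_mul_observerCoeff_mul hk₁ hk₂
  have hα := observerCoeff₁_pos hk₁ hk₂
  have hγ := observerCoeff₂_pos hk₁ hk₂
  unfold observerEnergy
  set α := observerCoeff₁ k₁ k₂
  set γ := observerCoeff₂ k₁ k₂
  -- Determinant over trace of the form is a lower bound for its smaller eigenvalue.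
  refine ⟨(α * γ - 1 / 4) / (α + γ), div_pos (by linarith) (by positivity), fun e₁ e₂ => ?_⟩
  have identity : (α + γ) * (α * e₁ ^ 2 - e₁ * e₂ + γ * e₂ ^ 2)
      = (α * γ - 1 / 4) * (e₁ ^ 2 + e₂ ^ 2) + ((α * e₁ - e₂ / 2) ^ 2 + (γ * e₂ - e₁ / 2) ^ 2) := by
    ring
  rw [div_mul_eq_mul_div, div_le_iff₀' (by positivity), identity]
  exact le_add_of_nonneg_right (by positivity)

theorem exists_observerEnergy_le_mul (hk₁ : 0 < k₁) (hk₂ : 0 < k₂) :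
    ∃ q : ℝ, 0 < q ∧ ∀ e₁ e₂, observerEnergy k₁ k₂ e₁ e₂ ≤ q * (e₁ ^ 2 + e₂ ^ 2) := by
  have hα := observerCoeff₁_pos hk₁ hk₂
  have hγ := observerCoeff₂_pos hk₁ hk₂
  refine ⟨observerCoeff₁ k₁ k₂ + observerCoeff₂ k₁ k₂ + 1 / 2, by positivity, fun e₁ e₂ => ?_⟩
  unfold observerEnergy
  nlinarith [sq_nonneg (e₁ + e₂), mul_nonneg hα.le (sq_nonneg e₂), mul_nonneg hγ.le (sq_nonneg e₁)]

theorem hasDerivAt_observerEnergy (hk₁ : k₁ ≠ 0) (hk₂ : k₂ ≠ 0) {σ δ t : ℝ} {ζ₁ ζ₂ : ℝ → ℝ}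
    (h₁ : HasDerivAt ζ₁ (ζ₂ t - σ * k₁ * ζ₁ t) t)
    (h₂ : HasDerivAt ζ₂ (δ - σ ^ 2 * k₂ * ζ₁ t) t) :
    HasDerivAt (fun t => observerEnergy k₁ k₂ (σ * ζ₁ t) (ζ₂ t))
      (-σ * ((σ * ζ₁ t) ^ 2 + ζ₂ t ^ 2)
        + δ * (2 * observerCoeff₂ k₁ k₂ * ζ₂ t - σ * ζ₁ t)) t := by
  have hα := two_mul_observerCoeff₁_mul hk₁ k₂
  have hγ := observerCoeff₂_mul k₁ hk₂
  have h₁' := h₁.const_mul σ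
  refine ((((h₁'.pow 2).const_mul (observerCoeff₁ k₁ k₂)).sub (h₁'.mul h₂)).add
    ((h₂.pow 2).const_mul (observerCoeff₂ k₁ k₂))).congr_deriv ?_
  simp only [Nat.cast_ofNat, Nat.add_one_sub_one, pow_one]
  linear_combination -σ * (σ * ζ₁ t) ^ 2 * hα - 2 * σ * (σ * ζ₁ t) * ζ₂ t * hγ

theorem mul_sub_le_young {σ D δ : ℝ} (hσ : 0 < σ) (hδ : |δ| ≤ D) (γ e₁ e₂ : ℝ) :
    δ * (2 * γ * e₂ - e₁) ≤ σ / 2 * (e₁ ^ 2 + e₂ ^ 2) + (1 + 4 * γ ^ 2) * D ^ 2 / (2 * σ) := by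
  have hδD : δ ^ 2 ≤ D ^ 2 := sq_le_sq' (abs_le.1 hδ).1 (abs_le.1 hδ).2
  have squares : σ / 2 * (e₁ ^ 2 + e₂ ^ 2) + (1 + 4 * γ ^ 2) * δ ^ 2 / (2 * σ)
      = δ * (2 * γ * e₂ - e₁)
        + ((σ * e₁ + δ) ^ 2 + (σ * e₂ - 2 * γ * δ) ^ 2) / (2 * σ) := by
    field_simp
    ring
  calc δ * (2 * γ * e₂ - e₁)
      ≤ σ / 2 * (e₁ ^ 2 + e₂ ^ 2) + (1 + 4 * γ ^ 2) * δ ^ 2 / (2 * σ) := by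
        rw [squares]
        exact le_add_of_nonneg_right (by positivity)
    _ ≤ _ := by gcongr

theorem eventually_observer_error_sq_le {D ε : ℝ} (hk₁ : 0 < k₁) (hk₂ : 0 < k₂) (hε : 0 < ε) :
    ∀ᶠ σ in atTop, ∀ ζ₁ ζ₂ δ : ℝ → ℝ,
      (∀ᶠ t in atTop, HasDerivAt ζ₁ (ζ₂ t - σ * k₁ * ζ₁ t) t) →
      (∀ᶠ t in atTop, HasDerivAt ζ₂ (δ t - σ ^ 2 * k₂ * ζ₁ t) t) →
      (∀ᶠ t in atTop, |δ t| ≤ D) →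
      ∀ᶠ t in atTop, ζ₁ t ^ 2 + ζ₂ t ^ 2 ≤ ε := by
  obtain ⟨p, hp, hpV⟩ := exists_pos_mul_le_observerEnergy hk₁ hk₂
  obtain ⟨q, hq, hVq⟩ := exists_observerEnergy_le_mul hk₁ hk₂
  set A : ℝ := (1 + 4 * observerCoeff₂ k₁ k₂ ^ 2) * D ^ 2
  have residual : Tendsto (fun σ : ℝ => q * (A / (2 * σ)) / (σ / 2 * p)) atTop (nhds 0) := by
    have hσ : Tendsto (fun σ : ℝ => q * A / p * σ⁻¹ * σ⁻¹) atTop (nhds 0) := by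
      simpa using (tendsto_inv_atTop_zero.const_mul (q * A / p)).mul
        (tendsto_inv_atTop_zero (𝕜 := ℝ))
    refine hσ.congr fun σ => ?_
    field_simp
  filter_upwards [eventually_ge_atTop 1, residual.eventually_lt_const hε]
    with σ hσ₁ hσ ζ₁ ζ₂ δ hζ₁ hζ₂ hδ
  have hσ₀ : 0 < σ := one_pos.trans_le hσ₁
  have decay : ∀ᶠ t in atTop, (σ * ζ₁ t) ^ 2 + ζ₂ t ^ 2 < ε := by
    refine eventually_lt_of_lyapunov hp hq (half_pos hσ₀) hσ (.of_forall fun t => hpV _ _)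
      (.of_forall fun t => hVq _ _) ?_
    filter_upwards [hζ₁, hζ₂, hδ] with t h₁ h₂ hδ
    refine ⟨_, hasDerivAt_observerEnergy hk₁.ne' hk₂.ne' h₁ h₂, ?_⟩
    linarith [mul_sub_le_young hσ₀ hδ (observerCoeff₂ k₁ k₂) (σ * ζ₁ t) (ζ₂ t)]
  filter_upwards [decay] with t ht
  have : ζ₁ t ^ 2 ≤ (σ * ζ₁ t) ^ 2 := by
    rw [mul_pow]
    exact le_mul_of_one_le_left (sq_nonneg _) (one_le_pow₀ hσ₁)
  linarith

end Observer

theorem exists_pos_mul_norm_sq_le_of_homogeneous {E : Type*} [NormedAddCommGroup E]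
    [NormedSpace ℝ E] [FiniteDimensional ℝ E] {Q : E → ℝ} (hQ : Continuous Q)
    (hsmul : ∀ (c : ℝ) x, Q (c • x) = c ^ 2 * Q x) (hpos : ∀ x, x ≠ 0 → 0 < Q x) :
    ∃ l : ℝ, 0 < l ∧ ∀ x, l * ‖x‖ ^ 2 ≤ Q x := by
  have hQ₀ : Q 0 = 0 := by simpa using hsmul 0 0
  rcases subsingleton_or_nontrivial E with _ | _
  · exact ⟨1, one_pos, fun x => by simp [Subsingleton.elim x 0, hQ₀]⟩
  have : ProperSpace E := FiniteDimensional.proper ℝ E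
  obtain ⟨z, hz, hmin⟩ := (isCompact_sphere (0 : E) 1).exists_isMinOn
    (NormedSpace.sphere_nonempty.2 zero_le_one) hQ.continuousOn
  refine ⟨Q z, hpos z (ne_zero_of_mem_unit_sphere ⟨z, hz⟩), fun x => ?_⟩
  rcases eq_or_ne x 0 with rfl | hx
  · simp [hQ₀]
  · have hQz : Q z ≤ Q (‖x‖⁻¹ • x) := hmin (by simp [norm_smul, hx])
    rw [hsmul, inv_pow, inv_mul_eq_div, le_div_iff₀ (by positivity)] at hQz
    exact hQz

section PinnedLaplacian

variable {ι : Type*} [Fintype ι] {a : ι → ι → ℝ} {b : ι → ℝ}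

/-- The quadratic form of the Laplacian of the graph with weights `a`, plus the diagonal matrix
with entries `b`, which pins the node `i` to zero with strength `b i`. -/
def pinnedLaplacianForm (a : ι → ι → ℝ) (b v : ι → ℝ) : ℝ :=
  ∑ i, v i * ((∑ k, a i k * (v i - v k)) + b i * v i)

theorem pinnedLaplacianForm_eq_sum_sq (hsymm : ∀ i k, a i k = a k i) (b v : ι → ℝ) :
    pinnedLaplacianForm a b v
      = (∑ i, ∑ k, a i k * (v i - v k) ^ 2) / 2 + ∑ i, b i * v i ^ 2 := by
  have swap : ∑ i, ∑ k, v k * (a i k * (v i - v k)) = -∑ i, ∑ k, v i * (a i k * (v i - v k)) := by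
    simp only [← Finset.sum_neg_distrib]
    rw [Finset.sum_comm]
    refine Finset.sum_congr rfl fun i _ => Finset.sum_congr rfl fun k _ => ?_
    rw [hsymm k i]
    ring
  have square : ∑ i, ∑ k, a i k * (v i - v k) ^ 2
      = ∑ i, ∑ k, v i * (a i k * (v i - v k)) - ∑ i, ∑ k, v k * (a i k * (v i - v k)) := by
    simp only [← Finset.sum_sub_distrib]
    refine Finset.sum_congr rfl fun i _ => Finset.sum_congr rfl fun k _ => ?_
    ring
  rw [square, swap, sub_neg_eq_add, add_self_div_two, ← Finset.sum_add_distrib]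
  refine Finset.sum_congr rfl fun i _ => ?_
  rw [mul_add, Finset.mul_sum]
  ring

theorem pinnedLaplacianForm_pos (ha : ∀ i k, 0 ≤ a i k) (hsymm : ∀ i k, a i k = a k i)
    (hb : ∀ i, 0 ≤ b i) {G : SimpleGraph ι} (hG : G.Preconnected)
    (hadj : ∀ i k, G.Adj i k → 0 < a i k) {l : ι} (hl : 0 < b l) {v : ι → ℝ} (hv : v ≠ 0) :
    0 < pinnedLaplacianForm a b v := by
  have edge_nonneg (i k : ι) : 0 ≤ a i k * (v i - v k) ^ 2 := mul_nonneg (ha i k) (sq_nonneg _)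
  have pin_nonneg (i : ι) : 0 ≤ b i * v i ^ 2 := mul_nonneg (hb i) (sq_nonneg _)
  have edges_nonneg : 0 ≤ ∑ i, ∑ k, a i k * (v i - v k) ^ 2 :=
    Fintype.sum_nonneg fun i => Fintype.sum_nonneg (edge_nonneg i)
  have pins_nonneg : 0 ≤ ∑ i, b i * v i ^ 2 := Fintype.sum_nonneg pin_nonneg
  rw [pinnedLaplacianForm_eq_sum_sq hsymm]
  by_contra! hle
  have edge_eq {i k : ι} (hik : G.Adj i k) : v i = v k := by
    have h : a i k * (v i - v k) ^ 2 ≤ ∑ i, ∑ k, a i k * (v i - v k) ^ 2 :=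
      (Finset.single_le_sum (fun k _ => edge_nonneg i k) (Finset.mem_univ k)).trans
        (Finset.single_le_sum (f := fun i => ∑ k, a i k * (v i - v k) ^ 2)
          (fun i _ => Fintype.sum_nonneg (edge_nonneg i)) (Finset.mem_univ i))
    have hzero : a i k * (v i - v k) ^ 2 = 0 := le_antisymm (by linarith) (edge_nonneg i k)
    simpa [(hadj i k hik).ne', sub_eq_zero] using hzero
  have pin_eq : v l = 0 := by
    have h := Finset.single_le_sum (fun i _ => pin_nonneg i) (Finset.mem_univ l)
    have hzero : b l * v l ^ 2 = 0 := le_antisymm (by linarith) (pin_nonneg l)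
    simpa [hl.ne'] using hzero
  have walk_eq {i k : ι} (p : G.Walk i k) : v i = v k := by
    induction p with
    | nil => rfl
    | cons hadj _ ih => exact (edge_eq hadj).trans ih
  refine hv (funext fun i => ?_)
  obtain ⟨p⟩ := hG i l
  exact (walk_eq p).trans pin_eq

theorem exists_pos_mul_sum_sq_le_pinnedLaplacianForm (ha : ∀ i k, 0 ≤ a i k)
    (hsymm : ∀ i k, a i k = a k i) (hb : ∀ i, 0 ≤ b i) {G : SimpleGraph ι} (hG : G.Preconnected)
    (hadj : ∀ i k, G.Adj i k → 0 < a i k) {l : ι} (hl : 0 < b l) :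
    ∃ c : ℝ, 0 < c ∧ ∀ v, c * ∑ i, v i ^ 2 ≤ pinnedLaplacianForm a b v := by
  obtain ⟨c, hc, h⟩ := exists_pos_mul_norm_sq_le_of_homogeneous (E := EuclideanSpace ℝ ι)
    (Q := fun v => pinnedLaplacianForm a b v) (by unfold pinnedLaplacianForm; fun_prop)
    (fun c v => by
      simp only [pinnedLaplacianForm_eq_sum_sq hsymm, PiLp.smul_apply, smul_eq_mul, ← mul_sub,
        mul_pow, mul_left_comm _ (c ^ 2), ← Finset.mul_sum, mul_div_assoc, ← mul_add])
    (fun v hv => pinnedLaplacianForm_pos ha hsymm hb hG hadj hl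
      (by simpa using hv))
  exact ⟨c, hc, fun v => by simpa [EuclideanSpace.real_norm_sq_eq] using h (WithLp.toLp 2 v)⟩

end PinnedLaplacian

namespace NashSeeking

section Nash

variable {N : ℕ} {f : Fin N → Profile N → ℝ}

theorem exists_lipschitzWith_pseudoGradient
    (hLip : ∀ i, ∃ K : ℝ≥0, LipschitzWith K (partialDeriv (f i) i)) :
    ∃ K, LipschitzWith K (pseudoGradient f) := by
  obtain ⟨K, hK⟩ := exists_lipschitzWith_pi (g := fun x i => partialDeriv (f i) i x) hLip
  exact ⟨_, (PiLp.lipschitzWith_toLp 2 fun _ : Fin N => ℝ).comp hK⟩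

theorem toLp_update_eq_add_smul_single (x : Profile N) (i : Fin N) (s : ℝ) :
    WithLp.toLp 2 (Function.update (fun j => x j) i s)
      = x + (s - x i) • EuclideanSpace.single i (1 : ℝ) := by
  ext j
  rcases eq_or_ne j i with rfl | h
  · simp
  · simp [h]

theorem hasDerivAt_comp_update {g : Profile N → ℝ} (hg : Differentiable ℝ g) (x : Profile N)
    (i : Fin N) (s : ℝ) :
    HasDerivAt (fun s => g (WithLp.toLp 2 (Function.update (fun j => x j) i s)))
      (partialDeriv g i (WithLp.toLp 2 (Function.update (fun j => x j) i s))) s := by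
  simp_rw [toLp_update_eq_add_smul_single]
  have axis : HasDerivAt (fun s : ℝ => x + (s - x i) • EuclideanSpace.single i (1 : ℝ))
      (EuclideanSpace.single i (1 : ℝ)) s := by
    simpa using (((hasDerivAt_id s).sub_const (x i)).smul_const
      (EuclideanSpace.single i (1 : ℝ))).const_add x
  exact (hg _).hasFDerivAt.comp_hasDerivAt s axis

theorem IsNashEquilibrium.pseudoGradient_eq_zero {xs : Profile N}
    (h : IsNashEquilibrium f xs) (hf : ∀ i, Differentiable ℝ (f i)) : pseudoGradient f xs = 0 := by
  ext i
  have update_self : WithLp.toLp 2 (Function.update (fun j => xs j) i (xs i)) = xs := by simp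
  have hmin : IsLocalMin
      (fun s => f i (WithLp.toLp 2 (Function.update (fun j => xs j) i s))) (xs i) :=
    Filter.Eventually.of_forall fun s => by simpa only [update_self] using h i s
  have hzero := hmin.hasDerivAt_eq_zero (hasDerivAt_comp_update (hf i) xs i (xs i))
  rwa [update_self] at hzero

theorem StronglyMonotone.mul_partialDeriv_update_nonneg (hmono : StronglyMonotone f)
    {xs : Profile N} (hxs : pseudoGradient f xs = 0) (i : Fin N) (s : ℝ) :
    0 ≤ (s - xs i) *
      partialDeriv (f i) i (WithLp.toLp 2 (Function.update (fun j => xs j) i s)) := by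
  obtain ⟨m, hm, hmono⟩ := hmono
  have h := hmono (WithLp.toLp 2 (Function.update (fun j => xs j) i s)) xs
  rw [hxs, sub_zero, toLp_update_eq_add_smul_single, add_sub_cancel_left, inner_smul_left,
    EuclideanSpace.inner_single_left, map_one, one_mul, conj_trivial,
    ← toLp_update_eq_add_smul_single] at h
  exact le_trans (by positivity) h

theorem StronglyMonotone.isNashEquilibrium (hmono : StronglyMonotone f)
    (hf : ∀ i, Differentiable ℝ (f i)) {xs : Profile N} (hxs : pseudoGradient f xs = 0) :
    IsNashEquilibrium f xs := by
  intro i s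
  set φ : ℝ → ℝ := fun s => f i (WithLp.toLp 2 (Function.update (fun j => xs j) i s))
  have hφ (s : ℝ) : HasDerivAt φ _ s := hasDerivAt_comp_update (hf i) xs i s
  have hφd : Differentiable ℝ φ := fun s => (hφ s).differentiableAt
  have hsign := hmono.mul_partialDeriv_update_nonneg hxs i
  have hmin : IsMinOn φ Set.univ (xs i) := by
    refine isMinOn_univ_of_deriv hφd.continuous.continuousAt hφd.differentiableOn
      hφd.differentiableOn (fun s hs => ?_) fun s hs => ?_ <;> rw [(hφ s).deriv]
    · exact nonpos_of_mul_nonneg_right (hsign s) (sub_neg.2 hs)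
    · exact nonneg_of_mul_nonneg_right (hsign s) (sub_pos.2 hs)
  simpa [φ] using hmin (Set.mem_univ s)

theorem StronglyMonotone.isNashEquilibrium_iff (hmono : StronglyMonotone f)
    (hf : ∀ i, Differentiable ℝ (f i)) {xs : Profile N} :
    IsNashEquilibrium f xs ↔ pseudoGradient f xs = 0 :=
  ⟨fun h => h.pseudoGradient_eq_zero hf, hmono.isNashEquilibrium hf⟩

theorem StronglyMonotone.existsUnique_isNashEquilibrium (hmono : StronglyMonotone f)
    (hf : ∀ i, Differentiable ℝ (f i))
    (hLip : ∀ i, ∃ K : ℝ≥0, LipschitzWith K (partialDeriv (f i) i)) :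
    ∃! xs : Profile N, IsNashEquilibrium f xs := by
  simp only [hmono.isNashEquilibrium_iff hf]
  obtain ⟨m, hm, hmono⟩ := hmono
  obtain ⟨K, hK⟩ := exists_lipschitzWith_pseudoGradient hLip
  exact existsUnique_eq_zero_of_stronglyMonotone hm hmono hK

end Nash

section Consensus

variable {N : ℕ} {a : Matrix (Fin N) (Fin N) ℝ}

/-- The quadratic form of the linear dynamics of the estimation errors `η i j = y i j - x j`: the
errors about the action of player `j` are pinned by `a i j` at the players `i` that observe it. -/
def consensusForm (a : Matrix (Fin N) (Fin N) ℝ) (η : Fin N → Profile N) : ℝ :=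
  ∑ j, pinnedLaplacianForm a (fun i => a i j) fun i => η i j

theorem exists_pos_mul_sum_norm_sq_le_consensusForm (hN : 2 ≤ N) (ha : ∀ i j, 0 ≤ a i j)
    (hsymm : ∀ i j, a i j = a j i)
    (hconn : (SimpleGraph.fromRel fun i j => 0 < a i j).Connected) :
    ∃ c : ℝ, 0 < c ∧ ∀ η : Fin N → Profile N, c * ∑ i, ‖η i‖ ^ 2 ≤ consensusForm a η := by
  have : Nontrivial (Fin N) := Fin.nontrivial_iff_two_le.2 hN
  have hadj (i k : Fin N) (hik : (SimpleGraph.fromRel fun i j => 0 < a i j).Adj i k) :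
      0 < a i k := by
    rw [SimpleGraph.fromRel_adj, hsymm k i, or_self] at hik
    exact hik.2
  have column (j : Fin N) : ∃ c : ℝ, 0 < c ∧
      ∀ v, c * ∑ i, v i ^ 2 ≤ pinnedLaplacianForm a (fun i => a i j) v := by
    obtain ⟨l, hl⟩ := hconn.preconnected.exists_adj_of_nontrivial j
    exact exists_pos_mul_sum_sq_le_pinnedLaplacianForm ha hsymm (fun i => ha i j)
      hconn.preconnected hadj (hadj l j hl.symm)
  choose c hc h using column
  obtain ⟨j₀, hj₀⟩ := Finite.exists_min c
  refine ⟨c j₀, hc j₀, fun η => ?_⟩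
  simp only [EuclideanSpace.real_norm_sq_eq]
  rw [Finset.sum_comm, Finset.mul_sum]
  refine Finset.sum_le_sum fun j _ => le_trans ?_ (h j _)
  gcongr
  exact hj₀ j

end Consensus

section Seeking

open Filter

variable {N : ℕ} {f : Fin N → Profile N → ℝ} {K : ℝ≥0} {m c : ℝ} {xs : Profile N}
  {θbar : Fin N → Fin N → ℝ}

/-- The pseudo-gradient with the `i`-th component evaluated at the profile `y i` estimated by
player `i`; it is `pseudoGradient f x` when all the estimates are equal to `x`. -/
noncomputable def estimatedGradient (f : Fin N → Profile N → ℝ) (y : Fin N → Profile N) :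
    Profile N :=
  WithLp.toLp 2 fun i => partialDeriv (f i) i (y i)

theorem norm_sq_estimatedGradient_sub_le (hK : ∀ i, LipschitzWith K (partialDeriv (f i) i))
    (y z : Fin N → Profile N) :
    ‖estimatedGradient f y - estimatedGradient f z‖ ^ 2 ≤ K ^ 2 * ∑ i, ‖y i - z i‖ ^ 2 := by
  rw [EuclideanSpace.norm_sq_eq, Finset.mul_sum]
  gcongr with i
  rw [← mul_pow]
  gcongr
  exact (hK i).norm_sub_le (y i) (z i)

theorem inner_velocity_le (hK : ∀ i, LipschitzWith K (partialDeriv (f i) i)) (hm : 0 < m)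
    (hmono : ∀ x z : Profile N,
      m * ‖x - z‖ ^ 2 ≤ inner ℝ (x - z) (pseudoGradient f x - pseudoGradient f z))
    (hxs : pseudoGradient f xs = 0) (x : Profile N) (y : Fin N → Profile N) (ζ : Profile N) :
    inner ℝ (x - xs) (ζ - estimatedGradient f y)
      ≤ (K ^ 2 * ∑ i, ‖y i - x‖ ^ 2 + ‖ζ‖ ^ 2) / m - m / 2 * ‖x - xs‖ ^ 2 := by
  set g := estimatedGradient f y - pseudoGradient f x
  have hg : ‖g‖ ^ 2 ≤ K ^ 2 * ∑ i, ‖y i - x‖ ^ 2 :=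
    norm_sq_estimatedGradient_sub_le hK y fun _ => x
  have young (w : Profile N) : inner ℝ (x - xs) w ≤ ‖w‖ ^ 2 / m + m / 4 * ‖x - xs‖ ^ 2 := by
    have identity : ‖w‖ ^ 2 / m + m / 4 * ‖x - xs‖ ^ 2 - ‖x - xs‖ * ‖w‖
        = (‖w‖ - m / 2 * ‖x - xs‖) ^ 2 / m := by
      field_simp
      ring
    have : 0 ≤ (‖w‖ - m / 2 * ‖x - xs‖) ^ 2 / m := by positivity
    linarith [real_inner_le_norm (x - xs) w]
  have hsplit : ζ - estimatedGradient f y = ζ + -g - pseudoGradient f x := by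
    simp only [g]
    abel
  have monotone := hmono x xs
  rw [hxs, sub_zero] at monotone
  calc inner ℝ (x - xs) (ζ - estimatedGradient f y)
      = inner ℝ (x - xs) ζ + inner ℝ (x - xs) (-g) - inner ℝ (x - xs) (pseudoGradient f x) := by
        rw [hsplit, inner_sub_right, inner_add_right]
    _ ≤ (‖ζ‖ ^ 2 / m + m / 4 * ‖x - xs‖ ^ 2) + (‖g‖ ^ 2 / m + m / 4 * ‖x - xs‖ ^ 2)
          - m * ‖x - xs‖ ^ 2 := by
        rw [← norm_neg g]
        linarith [young ζ, young (-g)]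
    _ = (‖g‖ ^ 2 + ‖ζ‖ ^ 2) / m - m / 2 * ‖x - xs‖ ^ 2 := by ring
    _ ≤ _ := by gcongr

theorem norm_sq_velocity_le (hK : ∀ i, LipschitzWith K (partialDeriv (f i) i))
    (hxs : pseudoGradient f xs = 0) (x : Profile N) (y : Fin N → Profile N) (ζ : Profile N) :
    ‖ζ - estimatedGradient f y‖ ^ 2
      ≤ 3 * (K ^ 2 * ∑ i, ‖y i - x‖ ^ 2 + N * K ^ 2 * ‖x - xs‖ ^ 2 + ‖ζ‖ ^ 2) := by
  have hy : ‖estimatedGradient f y - pseudoGradient f x‖ ^ 2 ≤ K ^ 2 * ∑ i, ‖y i - x‖ ^ 2 :=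
    norm_sq_estimatedGradient_sub_le hK y fun _ => x
  have hx : ‖pseudoGradient f x‖ ^ 2 ≤ N * K ^ 2 * ‖x - xs‖ ^ 2 := by
    have h := norm_sq_estimatedGradient_sub_le hK (fun _ => x) fun _ => xs
    change ‖pseudoGradient f x - pseudoGradient f xs‖ ^ 2 ≤ _ at h
    rw [hxs, sub_zero, Finset.sum_const, Finset.card_fin, nsmul_eq_mul] at h
    linarith
  have triangle : ‖ζ - estimatedGradient f y‖
      ≤ ‖estimatedGradient f y - pseudoGradient f x‖ + ‖pseudoGradient f x‖ + ‖ζ‖ := by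
    calc ‖ζ - estimatedGradient f y‖ ≤ ‖estimatedGradient f y‖ + ‖ζ‖ := by
          rw [add_comm]
          exact norm_sub_le _ _
      _ ≤ _ := by
          gcongr
          exact norm_le_norm_sub_add _ _
  calc ‖ζ - estimatedGradient f y‖ ^ 2
      ≤ (‖estimatedGradient f y - pseudoGradient f x‖ + ‖pseudoGradient f x‖ + ‖ζ‖) ^ 2 := by
        gcongr
    _ ≤ 3 * (‖estimatedGradient f y - pseudoGradient f x‖ ^ 2 + ‖pseudoGradient f x‖ ^ 2
          + ‖ζ‖ ^ 2) := by
        generalize ‖estimatedGradient f y - pseudoGradient f x‖ = p, ‖pseudoGradient f x‖ = q,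
          ‖ζ‖ = r
        linarith [sq_nonneg (p - q), sq_nonneg (p - r), sq_nonneg (q - r)]
    _ ≤ _ := by gcongr

theorem neg_sum_mul_le_young {w : Fin N → Fin N → ℝ} (hw : ∀ i j, 0 ≤ w i j)
    (hwc : ∀ i j, w i j ≤ c) {δ : ℝ} (hδ : 0 < δ) (η : Fin N → Profile N) (u : Profile N) :
    -∑ i, ∑ j, w i j * η i j * u j ≤ c ^ 2 / (4 * δ) * ∑ i, ‖η i‖ ^ 2 + δ * N * ‖u‖ ^ 2 := by
  have young (i j : Fin N) :
      -(w i j * η i j * u j) ≤ c ^ 2 / (4 * δ) * η i j ^ 2 + δ * u j ^ 2 := by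
    have square : w i j ^ 2 / (4 * δ) * η i j ^ 2 + δ * u j ^ 2 + w i j * η i j * u j
        = (w i j * η i j + 2 * δ * u j) ^ 2 / (4 * δ) := by
      field_simp
      ring
    have hsquare : 0 ≤ (w i j * η i j + 2 * δ * u j) ^ 2 / (4 * δ) := by positivity
    have hwsq : w i j ^ 2 / (4 * δ) * η i j ^ 2 ≤ c ^ 2 / (4 * δ) * η i j ^ 2 := by
      gcongr
      exacts [hw i j, hwc i j]
    linarith
  calc -∑ i, ∑ j, w i j * η i j * u j = ∑ i, ∑ j, -(w i j * η i j * u j) := by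
        simp only [Finset.sum_neg_distrib]
    _ ≤ ∑ i, ∑ j, (c ^ 2 / (4 * δ) * η i j ^ 2 + δ * u j ^ 2) :=
        Finset.sum_le_sum fun i _ => Finset.sum_le_sum fun j _ => young i j
    _ = c ^ 2 / (4 * δ) * ∑ i, ‖η i‖ ^ 2 + δ * N * ‖u‖ ^ 2 := by
        simp only [Finset.sum_add_distrib, ← Finset.mul_sum, Finset.sum_const, Finset.card_fin,
          nsmul_eq_mul, EuclideanSpace.real_norm_sq_eq]
        ring

theorem exists_velocity_contribution_le (hK : ∀ i, LipschitzWith K (partialDeriv (f i) i))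
    (hm : 0 < m)
    (hmono : ∀ x z : Profile N,
      m * ‖x - z‖ ^ 2 ≤ inner ℝ (x - z) (pseudoGradient f x - pseudoGradient f z))
    (hxs : pseudoGradient f xs = 0) {w : Fin N → Fin N → ℝ} (hw : ∀ i j, 0 ≤ w i j)
    (hwc : ∀ i j, w i j ≤ c) :
    ∃ C : ℝ, 0 < C ∧ ∀ (x : Profile N) (y : Fin N → Profile N) (ζ : Profile N),
      inner ℝ (x - xs) (ζ - estimatedGradient f y)
        - ∑ i, ∑ j, w i j * (y i - x) j * (ζ - estimatedGradient f y) j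
      ≤ C * (∑ i, ‖y i - x‖ ^ 2 + ‖ζ‖ ^ 2) - m / 4 * ‖x - xs‖ ^ 2 := by
  -- `δ` is so small that the velocity uses up at most half of the decay in `‖x - xs‖ ^ 2`.
  set δ : ℝ := m / (12 * (N ^ 2 * K ^ 2 + 1))
  have hδ : 0 < δ := by positivity
  have hδm : 3 * δ * N ^ 2 * K ^ 2 ≤ m / 4 := by
    have : δ * (12 * (N ^ 2 * K ^ 2 + 1)) = m := div_mul_cancel₀ _ (by positivity)
    linarith
  set C : ℝ := (K ^ 2 + 1) / m + c ^ 2 / (4 * δ) + 3 * δ * N * (K ^ 2 + 1)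
  have hC₁ : K ^ 2 / m + c ^ 2 / (4 * δ) + 3 * δ * N * K ^ 2 ≤ C := by
    have : C = K ^ 2 / m + c ^ 2 / (4 * δ) + 3 * δ * N * K ^ 2 + (1 / m + 3 * δ * N) := by ring
    exact this ▸ le_add_of_nonneg_right (by positivity)
  have hC₂ : 1 / m + 3 * δ * N ≤ C := by
    have : C = 1 / m + 3 * δ * N + (K ^ 2 / m + c ^ 2 / (4 * δ) + 3 * δ * N * K ^ 2) := by ring
    exact this ▸ le_add_of_nonneg_right (by positivity)
  refine ⟨C, by positivity, fun x y ζ => ?_⟩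
  set P := ∑ i, ‖y i - x‖ ^ 2
  have : 0 ≤ P := by positivity
  calc _ ≤ (K ^ 2 * P + ‖ζ‖ ^ 2) / m - m / 2 * ‖x - xs‖ ^ 2
          + (c ^ 2 / (4 * δ) * P + δ * N * ‖ζ - estimatedGradient f y‖ ^ 2) := by
        linarith [inner_velocity_le hK hm hmono hxs x y ζ,
          neg_sum_mul_le_young hw hwc hδ (fun i => y i - x) (ζ - estimatedGradient f y)]
    _ ≤ (K ^ 2 * P + ‖ζ‖ ^ 2) / m - m / 2 * ‖x - xs‖ ^ 2 + (c ^ 2 / (4 * δ) * P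
          + δ * N * (3 * (K ^ 2 * P + N * K ^ 2 * ‖x - xs‖ ^ 2 + ‖ζ‖ ^ 2))) := by
        gcongr
        exact norm_sq_velocity_le hK hxs x y ζ
    _ = (K ^ 2 / m + c ^ 2 / (4 * δ) + 3 * δ * N * K ^ 2) * P + (1 / m + 3 * δ * N) * ‖ζ‖ ^ 2
          + 3 * δ * N ^ 2 * K ^ 2 * ‖x - xs‖ ^ 2 - m / 2 * ‖x - xs‖ ^ 2 := by ring
    _ ≤ C * P + C * ‖ζ‖ ^ 2 + m / 4 * ‖x - xs‖ ^ 2 - m / 2 * ‖x - xs‖ ^ 2 := by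
        gcongr
    _ = _ := by ring

/-- The Lyapunov function of the seeking dynamics. Dividing the squared estimation errors by `θbar`
makes all of them decay at the common rate of the unweighted consensus dynamics. -/
noncomputable def seekingEnergy (θbar : Fin N → Fin N → ℝ) (xs x : Profile N)
    (y : Fin N → Profile N) : ℝ :=
  (∑ i, ∑ j, (θbar i j)⁻¹ * (y i j - x j) ^ 2 + ‖x - xs‖ ^ 2) / 2

theorem mul_le_seekingEnergy (hc : 1 ≤ c) (hθbar : ∀ i j, c⁻¹ ≤ (θbar i j)⁻¹) (xs x : Profile N)
    (y : Fin N → Profile N) :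
    c⁻¹ / 2 * (∑ i, ‖y i - x‖ ^ 2 + ‖x - xs‖ ^ 2) ≤ seekingEnergy θbar xs x y := by
  have : c⁻¹ * (∑ i, ‖y i - x‖ ^ 2 + ‖x - xs‖ ^ 2)
      ≤ ∑ i, ∑ j, (θbar i j)⁻¹ * (y i j - x j) ^ 2 + ‖x - xs‖ ^ 2 := by
    rw [mul_add]
    gcongr
    · simp only [EuclideanSpace.real_norm_sq_eq, Finset.mul_sum, PiLp.sub_apply]
      exact Finset.sum_le_sum fun i _ => Finset.sum_le_sum fun j _ =>
        mul_le_mul_of_nonneg_right (hθbar i j) (sq_nonneg _)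
    · exact mul_le_of_le_one_left (sq_nonneg _) (inv_le_one_of_one_le₀ hc)
  unfold seekingEnergy
  linarith

theorem seekingEnergy_le_mul (hc : 1 ≤ c) (hθbar : ∀ i j, (θbar i j)⁻¹ ≤ c) (xs x : Profile N)
    (y : Fin N → Profile N) :
    seekingEnergy θbar xs x y ≤ c / 2 * (∑ i, ‖y i - x‖ ^ 2 + ‖x - xs‖ ^ 2) := by
  have : ∑ i, ∑ j, (θbar i j)⁻¹ * (y i j - x j) ^ 2 + ‖x - xs‖ ^ 2
      ≤ c * (∑ i, ‖y i - x‖ ^ 2 + ‖x - xs‖ ^ 2) := by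
    rw [mul_add]
    gcongr
    · simp only [EuclideanSpace.real_norm_sq_eq, Finset.mul_sum, PiLp.sub_apply]
      exact Finset.sum_le_sum fun i _ => Finset.sum_le_sum fun j _ =>
        mul_le_mul_of_nonneg_right (hθbar i j) (sq_nonneg _)
    · exact le_mul_of_one_le_left (sq_nonneg _) hc
  unfold seekingEnergy
  linarith

theorem hasDerivAt_seekingEnergy (hθbar : ∀ i j, θbar i j ≠ 0) (xs : Profile N)
    {a : Matrix (Fin N) (Fin N) ℝ} {θ t : ℝ} {x : ℝ → Profile N} {y : ℝ → Fin N → Profile N}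
    {u : Profile N} (hx : ∀ j, HasDerivAt (fun s => x s j) (u j) t)
    (hy : ∀ i j, HasDerivAt (fun s => y s i j)
      (-(θ * θbar i j) * ((∑ k, a i k * (y t i j - y t k j)) + a i j * (y t i j - x t j))) t) :
    HasDerivAt (fun s => seekingEnergy θbar xs (x s) (y s))
      (-θ * consensusForm a (fun i => y t i - x t) + (inner ℝ (x t - xs) u
        - ∑ i, ∑ j, (θbar i j)⁻¹ * (y t i - x t) j * u j)) t := by
  have hη := HasDerivAt.fun_sum fun i (_ : i ∈ Finset.univ) =>
    HasDerivAt.fun_sum fun j (_ : j ∈ Finset.univ) =>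
      ((((hy i j).sub (hx j)).pow 2).const_mul (θbar i j)⁻¹)
  have hξ := HasDerivAt.fun_sum fun j (_ : j ∈ Finset.univ) => (((hx j).sub_const (xs j)).pow 2)
  simp only [seekingEnergy, EuclideanSpace.real_norm_sq_eq, PiLp.sub_apply]
  refine ((hη.add hξ).div_const 2).congr_deriv ?_
  have entry (i j : Fin N) : (θbar i j)⁻¹ * (2 * (y t i j - x t j) *
        (-(θ * θbar i j) * ((∑ k, a i k * (y t i j - y t k j)) + a i j * (y t i j - x t j))
          - u j))
      = -2 * θ * ((y t i j - x t j) * ((∑ k, a i k * (y t i j - y t k j))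
          + a i j * (y t i j - x t j))) - 2 * ((θbar i j)⁻¹ * (y t i j - x t j) * u j) := by
    field_simp [hθbar i j]
  have action : ∑ j, 2 * (x t j - xs j) * u j = 2 * inner ℝ (x t - xs) u := by
    simp only [PiLp.inner_apply, RCLike.inner_apply, conj_trivial, PiLp.sub_apply, mul_assoc,
      ← Finset.mul_sum, mul_comm (u _)]
  have consensus : consensusForm a (fun i => y t i - x t)
      = ∑ i, ∑ j, (y t i j - x t j) * ((∑ k, a i k * (y t i j - y t k j))
          + a i j * (y t i j - x t j)) := by
    rw [Finset.sum_comm]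
    simp only [consensusForm, pinnedLaplacianForm, PiLp.sub_apply, sub_sub_sub_cancel_right]
  simp only [Nat.cast_ofNat, Nat.add_one_sub_one, pow_one, Pi.sub_apply, entry, action, consensus,
    Finset.sum_sub_distrib, ← Finset.mul_sum]
  ring

theorem exists_seeking_gain (hN : 2 ≤ N) (hmono : StronglyMonotone f)
    (hLip : ∀ i, ∃ K : ℝ≥0, LipschitzWith K (partialDeriv (f i) i))
    {a : Matrix (Fin N) (Fin N) ℝ} (ha : ∀ i j, 0 ≤ a i j) (hsymm : ∀ i j, a i j = a j i)
    (hconn : (SimpleGraph.fromRel fun i j => 0 < a i j).Connected)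
    (hθbar : ∀ i j, 0 < θbar i j) (hxs : pseudoGradient f xs = 0) :
    ∃ θs C : ℝ, 0 < θs ∧ 0 < C ∧ ∀ θ, θs < θ →
      ∀ (x : ℝ → Profile N) (y : ℝ → Fin N → Profile N) (ζ : ℝ → Profile N),
      (∀ᶠ t in atTop, ∀ j,
        HasDerivAt (fun s => x s j) ((ζ t - estimatedGradient f (y t)) j) t) →
      (∀ᶠ t in atTop, ∀ i j, HasDerivAt (fun s => y s i j) (-(θ * θbar i j) *
        ((∑ k, a i k * (y t i j - y t k j)) + a i j * (y t i j - x t j))) t) →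
      ∀ b ε : ℝ, C * b < ε → (∀ᶠ t in atTop, ‖ζ t‖ ^ 2 ≤ b) →
      ∀ᶠ t in atTop, ∑ i, ‖y t i - x t‖ ^ 2 + ‖x t - xs‖ ^ 2 < ε := by
  obtain ⟨m, hm, hmono⟩ := hmono
  obtain ⟨K, hK⟩ := exists_lipschitzWith_forall hLip
  obtain ⟨c, hc, hcw⟩ := exists_one_le_forall_inv_le_and_le
    (w := fun p : Fin N × Fin N => (θbar p.1 p.2)⁻¹) fun p => inv_pos.2 (hθbar p.1 p.2)
  obtain ⟨l, hl, hcons⟩ := exists_pos_mul_sum_norm_sq_le_consensusForm hN ha hsymm hconn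
  obtain ⟨C, hC, hvel⟩ := exists_velocity_contribution_le hK hm hmono hxs
    (fun i j => (inv_pos.2 (hθbar i j)).le) fun i j => (hcw (i, j)).2
  have : 0 < c := one_pos.trans_le hc
  refine ⟨(C + m / 4) / l, c / 2 * C / (m / 4 * (c⁻¹ / 2)), by positivity, by positivity,
    fun θ hθ x y ζ hx hy b ε hε hζ => ?_⟩
  refine eventually_lt_of_lyapunov (b := C * b) (p := c⁻¹ / 2) (q := c / 2) (κ := m / 4)
    (by positivity) (by positivity) (by positivity) (by rwa [← mul_assoc, mul_div_right_comm])
    (.of_forall fun t => mul_le_seekingEnergy hc (fun i j => (hcw (i, j)).1) xs (x t) (y t))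
    (.of_forall fun t => seekingEnergy_le_mul hc (fun i j => (hcw (i, j)).2) xs (x t) (y t)) ?_
  filter_upwards [hx, hy, hζ] with t hx hy hζ
  refine ⟨_, hasDerivAt_seekingEnergy (fun i j => (hθbar i j).ne') xs hx hy, ?_⟩
  have consensus : (C + m / 4) * ∑ i, ‖y t i - x t‖ ^ 2
      ≤ θ * consensusForm a fun i => y t i - x t := by
    have hθl : C + m / 4 ≤ θ * l := ((div_lt_iff₀ hl).1 hθ).le
    have hθ₀ : 0 ≤ θ := le_trans (by positivity) hθ.le
    calc (C + m / 4) * ∑ i, ‖y t i - x t‖ ^ 2 ≤ θ * (l * ∑ i, ‖y t i - x t‖ ^ 2) := by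
          rw [← mul_assoc]
          gcongr
      _ ≤ θ * consensusForm a fun i => y t i - x t := by
          gcongr
          exact hcons _
  have disturbance : C * ‖ζ t‖ ^ 2 ≤ C * b := by gcongr
  linarith [hvel (x t) (y t) (ζ t)]

end Seeking

section ClosedLoop

variable {N : ℕ} {f : Fin N → Profile N → ℝ}

/-- The real coordinates of `State N`, in the order `x`, `y`, `xhat`, `zhat`. -/
abbrev StateIndex (N : ℕ) := Fin N ⊕ (Fin N × Fin N) ⊕ Fin N ⊕ Fin N

/-- The closed-loop state with the given coordinates. It transports the system to the normed space
`StateIndex N → ℝ`, where the theory of ordinary differential equations applies. -/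
def stateOfCoords (w : StateIndex N → ℝ) : State N where
  x := WithLp.toLp 2 fun i => w (.inl i)
  y i := WithLp.toLp 2 fun j => w (.inr (.inl (i, j)))
  xhat := WithLp.toLp 2 fun i => w (.inr (.inr (.inl i)))
  zhat := WithLp.toLp 2 fun i => w (.inr (.inr (.inr i)))

/-- The right-hand side of the closed-loop system in coordinates, without the disturbance. -/
noncomputable def closedLoopField (f : Fin N → Profile N → ℝ) (a : Matrix (Fin N) (Fin N) ℝ)
    (θbar : Fin N → Fin N → ℝ) (k₁ k₂ : Fin N → ℝ) (θ σ : ℝ) (S : State N) : StateIndex N → ℝ :=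
  Sum.elim (controlInput f S)
    (Sum.elim (fun p => -(θ * θbar p.1 p.2) * ((∑ k, a p.1 k * (S.y p.1 p.2 - S.y k p.2))
        + a p.1 p.2 * (S.y p.1 p.2 - S.x p.2)))
      (Sum.elim (fun i => controlInput f S i + S.zhat i + σ * k₁ i * (S.x i - S.xhat i))
        (fun i => σ ^ 2 * k₂ i * (S.x i - S.xhat i))))

theorem exists_lipschitzWith_controlInput
    (hLip : ∀ i, ∃ K : ℝ≥0, LipschitzWith K (partialDeriv (f i) i)) (i : Fin N) :
    ∃ K, LipschitzWith K fun w => controlInput f (stateOfCoords w) i := by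
  obtain ⟨K, hK⟩ := hLip i
  obtain ⟨L, hL⟩ := exists_lipschitzWith_pi
    (g := fun (w : StateIndex N → ℝ) j => w (.inr (.inl (i, j))))
    fun j => ⟨1, LipschitzWith.eval _⟩
  exact ⟨_, (hK.comp ((PiLp.lipschitzWith_toLp 2 fun _ : Fin N => ℝ).comp hL)).neg.sub
    (LipschitzWith.eval (α := fun _ : StateIndex N => ℝ) (.inr (.inr (.inr i))))⟩

theorem exists_lipschitzWith_closedLoopField
    (hLip : ∀ i, ∃ K : ℝ≥0, LipschitzWith K (partialDeriv (f i) i))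
    (a : Matrix (Fin N) (Fin N) ℝ) (θbar : Fin N → Fin N → ℝ) (k₁ k₂ : Fin N → ℝ) (θ σ : ℝ) :
    ∃ K, LipschitzWith K fun w => closedLoopField f a θbar k₁ k₂ θ σ (stateOfCoords w) := by
  have input (i : Fin N) := exists_lipschitzWith_controlInput hLip i
  have coord := LipschitzWith.eval (α := fun _ : StateIndex N => ℝ)
  have mul_sub (c : ℝ) (p q : StateIndex N) :
      LipschitzWith _ fun w : StateIndex N → ℝ => c * (w p - w q) :=
    (lipschitzWith_smul c).comp ((coord p).sub (coord q))
  refine exists_lipschitzWith_pi ?_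
  rintro (i | ⟨i, j⟩ | i | i)
  · exact input i
  · obtain ⟨K, hK⟩ := exists_lipschitzWith_sum Finset.univ fun k =>
      ⟨_, mul_sub (a i k) (.inr (.inl (i, j))) (.inr (.inl (k, j)))⟩
    exact ⟨_, (lipschitzWith_smul (-(θ * θbar i j))).comp (hK.add (mul_sub (a i j) _ (.inl j)))⟩
  · obtain ⟨K, hK⟩ := input i
    exact ⟨_, (hK.add (coord (.inr (.inr (.inr i))))).add (mul_sub _ _ _)⟩
  · exact ⟨_, mul_sub _ _ _⟩

theorem exists_isClosedLoopSolution
    (hLip : ∀ i, ∃ K : ℝ≥0, LipschitzWith K (partialDeriv (f i) i))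
    (a : Matrix (Fin N) (Fin N) ℝ) (θbar : Fin N → Fin N → ℝ) (k₁ k₂ : Fin N → ℝ)
    {d : Fin N → ℝ → ℝ} {t₀ : ℝ} (hd : ∀ i, ContinuousOn (d i) (Set.Ici t₀)) (θ σ : ℝ)
    (S₀ : State N) :
    ∃ S : ℝ → State N, S t₀ = S₀ ∧ IsClosedLoopSolution f a θbar k₁ k₂ d t₀ θ σ S := by
  obtain ⟨K, hK⟩ := exists_lipschitzWith_closedLoopField hLip a θbar k₁ k₂ θ σ
  let D : ℝ → StateIndex N → ℝ := fun t => Sum.elim (fun i => d i t) 0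
  have hD : ContinuousOn D (Set.Ici t₀) := by
    refine continuousOn_pi.2 ?_
    rintro (i | _)
    exacts [hd i, continuousOn_const]
  obtain ⟨w, hw₀, hw⟩ := exists_isIntegralCurveOn_Ici_of_lipschitzWith
    (v := fun t w => closedLoopField f a θbar k₁ k₂ θ σ (stateOfCoords w) + D t)
    (fun t _ => hK.add (LipschitzWith.const (D t))) (fun w => continuousOn_const.add hD)
    (Sum.elim (fun i => S₀.x i) (Sum.elim (fun p => S₀.y p.1 p.2)
      (Sum.elim (fun i => S₀.xhat i) (fun i => S₀.zhat i))))
  have hasDeriv (p : StateIndex N) (t : ℝ) (ht : t₀ ≤ t) := hasDerivWithinAt_pi.1 (hw t ht) p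
  refine ⟨fun t => stateOfCoords (w t), by simp only [hw₀]; rfl, ⟨?_, ?_, ?_, ?_⟩⟩
  · exact fun i => hasDeriv (.inl i)
  · exact fun i j t ht => (hasDeriv (.inr (.inl (i, j))) t ht).congr_deriv (add_zero _)
  · exact fun i t ht => (hasDeriv (.inr (.inr (.inl i))) t ht).congr_deriv (add_zero _)
  · exact fun i t ht => (hasDeriv (.inr (.inr (.inr i))) t ht).congr_deriv (add_zero _)

end ClosedLoop

section TotalError

open Filter

variable {N : ℕ} {f : Fin N → Profile N → ℝ} {a : Matrix (Fin N) (Fin N) ℝ}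
  {θbar : Fin N → Fin N → ℝ} {k₁ k₂ : Fin N → ℝ} {d : Fin N → ℝ → ℝ} {t₀ θ σ : ℝ}
  {S : ℝ → State N}

theorem norm_sq_totalError (xs : Profile N) (d : Fin N → ℝ → ℝ) (t : ℝ) (S : State N) :
    ‖totalError xs d t S‖ ^ 2 = ∑ i, ((S.x i - S.xhat i) ^ 2 + (d i t - S.zhat i) ^ 2)
      + (∑ i, ‖S.y i - S.x‖ ^ 2 + ‖S.x - xs‖ ^ 2) := by
  simp only [EuclideanSpace.real_norm_sq_eq, totalError, Fintype.sum_sum_type, Sum.elim_inl,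
    Sum.elim_inr, Fintype.sum_prod_type, Finset.sum_add_distrib, PiLp.sub_apply, add_assoc]

theorem IsClosedLoopSolution.hasDerivAt_x
    (hS : IsClosedLoopSolution f a θbar k₁ k₂ d t₀ θ σ S) {t : ℝ} (ht : t₀ < t) (i : Fin N) :
    HasDerivAt (fun s => (S s).x i)
      ((WithLp.toLp 2 (fun i => d i t - (S t).zhat i) - estimatedGradient f (S t).y) i) t := by
  refine ((hS.x_deriv i t ht.le).hasDerivAt (Ici_mem_nhds ht)).congr_deriv ?_
  simp only [controlInput, estimatedGradient, PiLp.sub_apply]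
  ring

theorem IsClosedLoopSolution.hasDerivAt_x_sub_xhat
    (hS : IsClosedLoopSolution f a θbar k₁ k₂ d t₀ θ σ S) {t : ℝ} (ht : t₀ < t) (i : Fin N) :
    HasDerivAt (fun s => (S s).x i - (S s).xhat i)
      (d i t - (S t).zhat i - σ * k₁ i * ((S t).x i - (S t).xhat i)) t := by
  refine (((hS.x_deriv i t ht.le).sub (hS.xhat_deriv i t ht.le)).hasDerivAt
    (Ici_mem_nhds ht)).congr_deriv ?_
  ring

theorem IsClosedLoopSolution.hasDerivAt_disturbance_sub_zhat
    (hS : IsClosedLoopSolution f a θbar k₁ k₂ d t₀ θ σ S) {i : Fin N}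
    (hd : DifferentiableOn ℝ (d i) (Set.Ici t₀)) {t : ℝ} (ht : t₀ < t) :
    HasDerivAt (fun s => d i s - (S s).zhat i) (derivWithin (d i) (Set.Ici t₀) t
      - σ ^ 2 * k₂ i * ((S t).x i - (S t).xhat i)) t :=
  ((hd t ht.le).hasDerivWithinAt.sub (hS.zhat_deriv i t ht.le)).hasDerivAt (Ici_mem_nhds ht)

theorem eventually_sum_observer_error_sq_le (hk₁ : ∀ i, 0 < k₁ i) (hk₂ : ∀ i, 0 < k₂ i)
    (hd : ∀ i, DifferentiableOn ℝ (d i) (Set.Ici t₀))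
    (hdb : ∀ i, ∃ D : ℝ, ∀ t, t₀ ≤ t → |derivWithin (d i) (Set.Ici t₀) t| ≤ D)
    (f : Fin N → Profile N → ℝ) (a : Matrix (Fin N) (Fin N) ℝ) (θbar : Fin N → Fin N → ℝ)
    {b : ℝ} (hb : 0 < b) :
    ∀ᶠ σ in atTop, ∀ (θ : ℝ) (S : ℝ → State N),
      IsClosedLoopSolution f a θbar k₁ k₂ d t₀ θ σ S →
      ∀ᶠ t in atTop, ∑ i, (((S t).x i - (S t).xhat i) ^ 2 + (d i t - (S t).zhat i) ^ 2) ≤ b := by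
  choose D hD using hdb
  have player (i : Fin N) := eventually_observer_error_sq_le (D := D i) (ε := b / (N + 1))
    (hk₁ i) (hk₂ i) (by positivity)
  filter_upwards [eventually_all.2 player] with σ hσ θ S hS
  have error_le (i : Fin N) : ∀ᶠ t in atTop,
      ((S t).x i - (S t).xhat i) ^ 2 + (d i t - (S t).zhat i) ^ 2 ≤ b / (N + 1) := by
    refine hσ i _ _ (derivWithin (d i) (Set.Ici t₀)) ?_ ?_
      ((eventually_ge_atTop t₀).mono (hD i))
    · exact (eventually_gt_atTop t₀).mono fun t ht => hS.hasDerivAt_x_sub_xhat ht i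
    · exact (eventually_gt_atTop t₀).mono fun t ht =>
        hS.hasDerivAt_disturbance_sub_zhat (hd i) ht
  filter_upwards [eventually_all.2 error_le] with t ht
  calc _ ≤ ∑ _ : Fin N, b / (N + 1) := Finset.sum_le_sum fun i _ => ht i
    _ = N * (b / (N + 1)) := by simp
    _ ≤ b := by
        rw [mul_div_assoc', div_le_iff₀ (by positivity)]
        linarith

theorem exists_consensus_gain_eventually_norm_totalError_le (hN : 2 ≤ N)
    (hmono : StronglyMonotone f)
    (hLip : ∀ i, ∃ K : ℝ≥0, LipschitzWith K (partialDeriv (f i) i))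
    (ha : ∀ i j, 0 ≤ a i j) (hsymm : ∀ i j, a i j = a j i)
    (hconn : (SimpleGraph.fromRel fun i j => 0 < a i j).Connected)
    (hd : ∀ i, DifferentiableOn ℝ (d i) (Set.Ici t₀))
    (hdb : ∀ i, ∃ D : ℝ, ∀ t, t₀ ≤ t → |derivWithin (d i) (Set.Ici t₀) t| ≤ D)
    (hθbar : ∀ i j, 0 < θbar i j) (hk₁ : ∀ i, 0 < k₁ i) (hk₂ : ∀ i, 0 < k₂ i) {xs : Profile N}
    (hxs : pseudoGradient f xs = 0) :
    ∃ θs : ℝ, 0 < θs ∧ ∀ v : ℝ, 0 < v → ∀ᶠ σ in atTop, ∀ θ, θs < θ → ∀ S : ℝ → State N,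
      IsClosedLoopSolution f a θbar k₁ k₂ d t₀ θ σ S →
      ∀ᶠ t in atTop, ‖totalError xs d t (S t)‖ ≤ v := by
  obtain ⟨θs, C, hθs, hC, hseek⟩ := exists_seeking_gain hN hmono hLip ha hsymm hconn hθbar hxs
  refine ⟨θs, hθs, fun v hv => ?_⟩
  set b := v ^ 2 / (C + 2)
  have hb : 0 < b := by positivity
  filter_upwards [eventually_sum_observer_error_sq_le hk₁ hk₂ hd hdb f a θbar hb]
    with σ hσ θ hθ S hS
  have observer := hσ θ S hS
  have disturbance : ∀ᶠ t in atTop,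
      ‖WithLp.toLp 2 fun i => d i t - (S t).zhat i‖ ^ 2 ≤ b := by
    filter_upwards [observer] with t ht
    rw [EuclideanSpace.real_norm_sq_eq]
    exact (Finset.sum_le_sum fun i _ => le_add_of_nonneg_left (sq_nonneg _)).trans ht
  have seeking := hseek θ hθ (fun t => (S t).x) (fun t => (S t).y) _
    ((eventually_gt_atTop t₀).mono fun t ht => hS.hasDerivAt_x ht)
    ((eventually_gt_atTop t₀).mono fun t ht i j =>
      (hS.y_deriv i j t ht.le).hasDerivAt (Ici_mem_nhds ht))
    b ((C + 1) * b) (by linarith) disturbance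
  filter_upwards [observer, seeking] with t hobserver hseeking
  have hbv : b + (C + 1) * b = v ^ 2 := by
    have : b * (C + 2) = v ^ 2 := div_mul_cancel₀ _ (by positivity)
    linarith
  refine le_of_sq_le_sq ?_ hv.le
  rw [norm_sq_totalError, ← hbv]
  exact add_le_add hobserver hseeking.le

end TotalError

end NashSeeking

theorem corollary1_general (N : ℕ) (hN : 2 ≤ N)
    (f : Fin N → NashSeeking.Profile N → ℝ)
    (hf : ∀ i, Differentiable ℝ (f i))
    (hmono : NashSeeking.StronglyMonotone f)
    (hLip : ∀ i, ∃ K : ℝ≥0, LipschitzWith K (NashSeeking.partialDeriv (f i) i))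
    (a : Matrix (Fin N) (Fin N) ℝ) (ha : ∀ i j, 0 ≤ a i j) (hsymm : ∀ i j, a i j = a j i)
    (hconn : (SimpleGraph.fromRel fun i j => 0 < a i j).Connected)
    (t₀ : ℝ) (d : Fin N → ℝ → ℝ) (hd : ∀ i, DifferentiableOn ℝ (d i) (Set.Ici t₀))
    (hdb : ∀ i, ∃ D : ℝ, ∀ t, t₀ ≤ t → |derivWithin (d i) (Set.Ici t₀) t| ≤ D)
    (θbar : Fin N → Fin N → ℝ) (hθbar : ∀ i j, 0 < θbar i j)
    (k₁ k₂ : Fin N → ℝ) (hk₁ : ∀ i, 0 < k₁ i) (hk₂ : ∀ i, 0 < k₂ i) :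
    (∃! xs : NashSeeking.Profile N, NashSeeking.IsNashEquilibrium f xs) ∧
    ∀ xs : NashSeeking.Profile N, NashSeeking.IsNashEquilibrium f xs →
      ∃ θs : ℝ, 0 < θs ∧ ∀ v₁ : ℝ, 0 < v₁ → ∃ σs : ℝ, 0 < σs ∧
        ∀ θ : ℝ, θs < θ → ∀ σ : ℝ, σs < σ →
          (∀ S₀ : NashSeeking.State N, ∃ S : ℝ → NashSeeking.State N, S t₀ = S₀ ∧
            NashSeeking.IsClosedLoopSolution f a θbar k₁ k₂ d t₀ θ σ S) ∧
          ∀ S : ℝ → NashSeeking.State N,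
            NashSeeking.IsClosedLoopSolution f a θbar k₁ k₂ d t₀ θ σ S →
            ∃ T : ℝ, t₀ ≤ T ∧ ∀ t : ℝ, T ≤ t →
              ‖NashSeeking.totalError xs d t (S t)‖ ≤ v₁ := by
  refine ⟨hmono.existsUnique_isNashEquilibrium hf hLip, fun xs hxs => ?_⟩
  obtain ⟨θs, hθs, hbound⟩ := NashSeeking.exists_consensus_gain_eventually_norm_totalError_le
    hN hmono hLip ha hsymm hconn hd hdb hθbar hk₁ hk₂ (hxs.pseudoGradient_eq_zero hf)
  refine ⟨θs, hθs, fun v hv => ?_⟩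
  obtain ⟨σs, hσs, hσ⟩ := ((Filter.atTop_basis_Ioi' 0).eventually_iff).1 (hbound v hv)
  refine ⟨σs, hσs, fun θ hθ σ hσσ => ⟨fun S₀ => ?_, fun S hS => ?_⟩⟩
  · exact NashSeeking.exists_isClosedLoopSolution hLip a θbar k₁ k₂
      (fun i => (hd i).continuousOn) θ σ S₀
  · exact ((Filter.eventually_ge_atTop t₀).and (hσ hσσ θ hθ S hS)).exists_forall_of_atTop.imp
      fun T hT => ⟨(hT T le_rfl).1, fun t ht => (hT t ht).2⟩

theorem corollary1 (N : ℕ) (hN : 2 ≤ N)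
    (f : Fin N → NashSeeking.Profile N → ℝ)
    (hf : ∀ i, ContDiff ℝ 2 (f i))
    (hmono : NashSeeking.StronglyMonotone f)
    (hLip : ∀ i, ∃ K : ℝ≥0, LipschitzWith K (NashSeeking.partialDeriv (f i) i))
    (a : Matrix (Fin N) (Fin N) ℝ) (ha : NashSeeking.IsUndirectedConnected a)
    (t₀ : ℝ) (d : Fin N → ℝ → ℝ) (hd : NashSeeking.IsAdmissibleDisturbance t₀ d)
    (θbar : Fin N → Fin N → ℝ) (hθbar : ∀ i j, 0 < θbar i j)
    (k₁ k₂ : Fin N → ℝ) (hk₁ : ∀ i, 0 < k₁ i) (hk₂ : ∀ i, 0 < k₂ i) :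
    (∃! xs : NashSeeking.Profile N, NashSeeking.IsNashEquilibrium f xs) ∧
    ∀ xs : NashSeeking.Profile N, NashSeeking.IsNashEquilibrium f xs →
      ∃ θs : ℝ, 0 < θs ∧ ∀ v₁ : ℝ, 0 < v₁ → ∃ σs : ℝ, 0 < σs ∧
        ∀ θ : ℝ, θs < θ → ∀ σ : ℝ, σs < σ →
          (∀ S₀ : NashSeeking.State N, ∃ S : ℝ → NashSeeking.State N, S t₀ = S₀ ∧
            NashSeeking.IsClosedLoopSolution f a θbar k₁ k₂ d t₀ θ σ S) ∧
          ∀ S : ℝ → NashSeeking.State N,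
            NashSeeking.IsClosedLoopSolution f a θbar k₁ k₂ d t₀ θ σ S →
            ∃ T : ℝ, t₀ ≤ T ∧ ∀ t : ℝ, T ≤ t →
              ‖NashSeeking.totalError xs d t (S t)‖ ≤ v₁ :=
  corollary1_general N hN f (fun i => (hf i).differentiable two_ne_zero) hmono hLip a ha.nonneg
    ha.symm ha.connected t₀ d (fun i => (hd.contDiffOn i).differentiableOn one_ne_zero) hd.bounded
    θbar hθbar k₁ k₂ hk₁ hk₂
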